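/- Let $k\ge 2$, let $(\chi,d)$ be a metric space, and put $d_{\max}(p_1,\dots,p_k)=\max_{i,j}d(p_i,p_j)$ (for $\chi=\mathbb R$ this is the diameter on a line). **Problem.** An instance $\sigma$ consists of $m$ requests $V=\{u_1,\dots,u_m\}$, $k\mid m$, with positions $\mathrm{pos}(u_i)\in\chi$ and arrival times $0\le \mathrm{atime}(u_1)\le\dots\le\mathrm{atime}(u_m)$. A solution partitions $V$ into sets of $k$ requests and matches each set $F$ at a time $\tau_F\ge\max_{v\in F}\mathrm{atime}(v)$; matching $F=\{v_1,\dots,v_k\}$ costs $d_{\max}(\mathrm{pos}(v_1),\dots,\mathrm{pos}(v_k))+\sum_{i}(\tau_F-\mathrm{atime}(v_i))$. Let $\mathcal{OPT}(\sigma)$ be the least total cost of a solution. **Dual program.** For $S\subseteq V$ put $\mathrm{sur}(S)=|S|\bmod k$, and for distinct $u,v\in V$ with $p=\mathrm{pos}(u)$, $q=\mathrm{pos}(v)$ put $\mathrm{opt\text{-}cost}(u,v)=d_{\max}(p,q,\dots,q)+d_{\max}(q,p,\dots,p)+|\mathrm{atime}(u)-\mathrm{atime}(v)|$. Let $\mathcal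 D'(\sigma)$ be the optimal value of: maximize $\sum_{S\subseteq V}\mathrm{sur}(S)\,(k-\mathrm{sur}(S))\,y_S$ subject to $y_S\ge 0$ for all $S\subseteq V$ and $\sum_{S:\,|S\cap\{u,v\}|=1}y_S\le\frac1{k^2}\mathrm{opt\text{-}cost}(u,v)$ for all $u\ne v$. **Algorithm GD-$k$.** It maintains active sets that partition the requests arrived so far, variables $y_S$, and the groups matched so far; a request is free if it is not yet matched. When $v$ arrives, $\{v\}$ becomes active and $y_S:=0$ for all $S\ni v$. Whenever there is an arrived pair $(u,v)$ in distinct active sets $A\ni u$, $B\ni v$ with $\sum_{S:\,|S\cap\{u,v\}|=1}y_S=\frac1{k^2}\mathrm{opt\text{-}cost}(u,v)$, the sets $A,B$ are replaced by $A\cup B$, the pair is marked, and while $A\cup B$ contains at least $k$ free requests, an arbitrary $k$ of them are matched at the current time. Otherwise time passes, and $y_S$ grows at rate $1/k^2$ for every active $S$ that contains a free request. Simultaneous events are processed in an arbitrary order, except that the requests arrive in the order $u_1,\dots,u_m$. **Theorem.** For every such instance $\sigma$, $\mathcal D'(\sigma)$ is finite, $\mathcal D'(\sigma)\le\mathcal{OPT}(\sigma)$,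 and every execution of GD-$k$ on $\sigma$ processes finitely many events, matches all the requests, and produces a solution whose total cost is at most $$(4m+k^2)\,\mathcal D'(\sigma)\;\le\;(4m+k^2)\,\mathcal{OPT}(\sigma).$$ In particular GD-$k$ is $O(m+k^2)$-competitive for $k$-MPMD on $(\chi,d_{\max})$. -/

import Mathlib

noncomputable section

namespace MPMD

/-! ### Instances, schedules and the offline optimum -/

/-- An instance with `m` requests `0, …, m - 1` located in `χ`, listed in order of arrival. -/
structure Inst (χ : Type*) (m : ℕ) where
  /-- arrival times -/
  atime : Fin m → ℝ
  /-- locations -/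
  pos : Fin m → χ
  atime_nonneg : ∀ v, 0 ≤ atime v
  atime_mono : Monotone atime

/-- The `k`-point metric `d_max (p₁, …, p_k) = max_{i, j} d (p_i, p_j)` of a metric space. -/
def dMax {χ : Type*} [MetricSpace χ] (k : ℕ) (p : Fin k → χ) : ℝ :=
  ⨆ ij : Fin k × Fin k, dist (p ij.1) (p ij.2)

/-- The distance `d_H (pos v₁, …, pos v_k)` of a set `F = {v₁, …, v_k}` of `k` requests (enumerated
increasingly; `d_H` is meant to be symmetric). It is used only for sets with `k` elements. -/
def groupDist {χ : Type*} {k m : ℕ} (dH : (Fin k → χ) → ℝ) (σ : Inst χ m)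
    (F : Finset (Fin m)) : ℝ :=
  if h : F.card = k then dH (fun i => σ.pos (F.orderEmbOfFin h i)) else 0

/-- A family of pairwise disjoint `k`-element sets that covers all the requests. -/
def IsPerfectMatching (k : ℕ) {m : ℕ} (M : Finset (Finset (Fin m))) : Prop :=
  (∀ F ∈ M, F.card = k) ∧ (∀ F ∈ M, ∀ G ∈ M, F ≠ G → Disjoint F G) ∧ ∀ v, ∃ F ∈ M, v ∈ F

/-- The sets of the perfect `k`-way matching `M` are matched at the times `t`, each one not before
all of its requests have arrived. -/
def IsSchedule (k : ℕ) {χ : Type*} {m : ℕ} (σ : Inst χ m)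
    (M : Finset (Finset (Fin m))) (t : Finset (Fin m) → ℝ) : Prop :=
  IsPerfectMatching k M ∧ ∀ F ∈ M, ∀ v ∈ F, σ.atime v ≤ t F

/-- The total cost (distance cost plus waiting cost) of matching each `F ∈ M` at time `t F`. -/
def cost {χ : Type*} {k m : ℕ} (dH : (Fin k → χ) → ℝ) (σ : Inst χ m)
    (M : Finset (Finset (Fin m))) (t : Finset (Fin m) → ℝ) : ℝ :=
  ∑ F ∈ M, (groupDist dH σ F + ∑ v ∈ F, (t F - σ.atime v))

/-- The offline optimum: the least cost of a perfect matching together with matching times. -/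
def opt {χ : Type*} {k m : ℕ} (dH : (Fin k → χ) → ℝ) (σ : Inst χ m) : ℝ :=
  sInf {c | ∃ M t, IsSchedule k σ M t ∧ c = cost dH σ M t}

/-! ### The dual linear program -/

/-- The two-point distance `d (p, q) = d_H (p, q, …, q) + d_H (q, p, …, p)`. -/
def pairDist {χ : Type*} {k : ℕ} (dH : (Fin k → χ) → ℝ) (p q : χ) : ℝ :=
  dH (fun i => if (i : ℕ) = 0 then p else q) + dH (fun i => if (i : ℕ) = 0 then q else p)

/-- `opt-cost (e)` for a pair `e = (u, v)` of requests. -/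
def edgeCost {χ : Type*} {k m : ℕ} (dH : (Fin k → χ) → ℝ) (σ : Inst χ m) (u v : Fin m) : ℝ :=
  pairDist dH (σ.pos u) (σ.pos v) + |σ.atime u - σ.atime v|

/-- The rate `r = 1 / (γ k²)`. -/
def rate (k : ℕ) (γ : ℝ) : ℝ := 1 / (γ * (k : ℝ) ^ 2)

/-- `∑ y_S` over the sets `S` of requests that contain exactly one of `u`, `v`. -/
def cutSum {m : ℕ} (y : Finset (Fin m) → ℝ) (u v : Fin m) : ℝ :=
  ∑ S : Finset (Fin m) with ¬ (u ∈ S ↔ v ∈ S), y S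

/-- `sur (S) = |S| mod k`. -/
def sur (k : ℕ) {m : ℕ} (S : Finset (Fin m)) : ℕ := S.card % k

/-- Feasibility for the dual linear program. -/
def DualFeasible {χ : Type*} {k m : ℕ} (dH : (Fin k → χ) → ℝ) (γ : ℝ) (σ : Inst χ m)
    (y : Finset (Fin m) → ℝ) : Prop :=
  (∀ S, 0 ≤ y S) ∧ ∀ u v, u ≠ v → cutSum y u v ≤ rate k γ * edgeCost dH σ u v

/-- The objective function of the dual linear program. -/
def dualObjective (k : ℕ) {m : ℕ} (y : Finset (Fin m) → ℝ) : ℝ :=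
  ∑ S : Finset (Fin m), (sur k S : ℝ) * ((k : ℝ) - (sur k S : ℝ)) * y S

/-- The objective values of the feasible solutions of the dual linear program. -/
def dualValues {χ : Type*} {k m : ℕ} (dH : (Fin k → χ) → ℝ) (γ : ℝ) (σ : Inst χ m) : Set ℝ :=
  {c | ∃ y, DualFeasible dH γ σ y ∧ c = dualObjective k y}

/-- The optimal value `D'(σ)` of the dual linear program. -/
def dualOpt {χ : Type*} {k m : ℕ} (dH : (Fin k → χ) → ℝ) (γ : ℝ) (σ : Inst χ m) : ℝ :=
  sSup (dualValues dH γ σ)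

/-! ### The algorithm Greedy Dual -/

/-- The data that the algorithm maintains. -/
structure State (m : ℕ) where
  /-- the current time -/
  time : ℝ
  /-- the number of requests arrived so far: these are the requests `v` with `v < arrived` -/
  arrived : ℕ
  /-- the family of active sets -/
  active : Finset (Finset (Fin m))
  /-- the dual variables -/
  y : Finset (Fin m) → ℝ
  /-- the marked edges -/
  marked : Finset (Sym2 (Fin m))
  /-- the sets matched so far -/
  matching : Finset (Finset (Fin m))
  /-- the times at which the members of `matching` were matched -/
  mtime : Finset (Fin m) → ℝ

/-- The state at time `0`, before any request is processed. -/
def State.start (m : ℕ) : State m where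
  time := 0
  arrived := 0
  active := ∅
  y := fun _ => 0
  marked := ∅
  matching := ∅
  mtime := fun _ => 0

/-- The free (not yet matched) requests in `S`. -/
def State.free {m : ℕ} (s : State m) (S : Finset (Fin m)) : Finset (Fin m) :=
  S.filter (fun v => ∀ F ∈ s.matching, v ∉ F)

/-- All the requests have arrived and are matched. -/
def State.Complete {m : ℕ} (s : State m) : Prop :=
  s.arrived = m ∧ s.free Finset.univ = ∅

/-- Arrival of the next request `v`. -/
def State.arrive {m : ℕ} (s : State m) (v : Fin m) : State m :=
  { s with
    arrived := s.arrived + 1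
    active := insert {v} s.active
    y := fun S => if v ∈ S then 0 else s.y S }

/-- Merging the active sets `A ∋ u` and `B ∋ v`, marking the pair `(u, v)`, and matching the members
of `P` at the current time. -/
def State.merge {m : ℕ} (s : State m) (A B : Finset (Fin m)) (u v : Fin m)
    (P : Finset (Finset (Fin m))) : State m :=
  { s with
    active := insert (A ∪ B) ((s.active.erase A).erase B)
    marked := insert s(u, v) s.marked
    matching := s.matching ∪ P
    mtime := fun F => if F ∈ P then s.time else s.mtime F }

/-- Letting `δ` units of time pass: `y_S` grows at rate `r` for the active sets `S` that contain a
free request. -/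
def State.grow {m : ℕ} (s : State m) (r δ : ℝ) : State m :=
  { s with
    time := s.time + δ
    y := fun S => if S ∈ s.active ∧ (s.free S).Nonempty then s.y S + r * δ else s.y S }

/-- `P` consists of disjoint `k`-element subsets of `X` that leave fewer than `k` elements of `X`
uncovered. -/
def IsPacking (k : ℕ) {m : ℕ} (X : Finset (Fin m)) (P : Finset (Finset (Fin m))) : Prop :=
  (∀ F ∈ P, F.card = k ∧ F ⊆ X) ∧ (∀ F ∈ P, ∀ G ∈ P, F ≠ G → Disjoint F G) ∧
    (X.filter (fun v => ∀ F ∈ P, v ∉ F)).card < k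

/-- The next request `v` arrives now. -/
def ArrivesNow {χ : Type*} {m : ℕ} (σ : Inst χ m) (s : State m) (v : Fin m) : Prop :=
  (v : ℕ) = s.arrived ∧ σ.atime v = s.time

/-- `(u, v)` is a tight edge between two distinct active sets `A ∋ u` and `B ∋ v`. -/
def TightBetween {χ : Type*} {k m : ℕ} (dH : (Fin k → χ) → ℝ) (γ : ℝ) (σ : Inst χ m)
    (s : State m) (A B : Finset (Fin m)) (u v : Fin m) : Prop :=
  A ∈ s.active ∧ B ∈ s.active ∧ A ≠ B ∧ u ∈ A ∧ v ∈ B ∧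
    cutSum s.y u v = rate k γ * edgeCost dH σ u v

/-- A request arrives now, or there is a tight edge between distinct active sets. -/
def Event {χ : Type*} {k m : ℕ} (dH : (Fin k → χ) → ℝ) (γ : ℝ) (σ : Inst χ m)
    (s : State m) : Prop :=
  (∃ v, ArrivesNow σ s v) ∨ ∃ A B u v, TightBetween dH γ σ s A B u v

/-- One step of Greedy Dual. The order of simultaneous events and the sets of free requests that are
matched after a merge are arbitrary; if there is nothing to process, time passes up to the next
event. -/
inductive Step {χ : Type*} {k m : ℕ} (dH : (Fin k → χ) → ℝ) (γ : ℝ) (σ : Inst χ m) :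
    State m → State m → Prop
  | arrive (s : State m) (v : Fin m) (hv : ArrivesNow σ s v) : Step dH γ σ s (s.arrive v)
  | merge (s : State m) (A B : Finset (Fin m)) (u v : Fin m) (P : Finset (Finset (Fin m)))
      (h : TightBetween dH γ σ s A B u v) (hP : IsPacking k (s.free (A ∪ B)) P) :
      Step dH γ σ s (s.merge A B u v P)
  | wait (s : State m) (δ : ℝ) (hδ : 0 < δ)
      (hbefore : ∀ ε, 0 ≤ ε → ε < δ → ¬ Event dH γ σ (s.grow (rate k γ) ε))
      (hat : Event dH γ σ (s.grow (rate k γ) δ)) :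
      Step dH γ σ s (s.grow (rate k γ) δ)

/-- The states that an execution of Greedy Dual can reach. -/
def Reachable {χ : Type*} {k m : ℕ} (dH : (Fin k → χ) → ℝ) (γ : ℝ) (σ : Inst χ m)
    (s : State m) : Prop :=
  Relation.ReflTransGen (Step dH γ σ) (State.start m) s

end MPMD

end

namespace MPMD

variable {χ : Type*} {k m : ℕ}

/-! ### Packings -/

/-- A sum over `X` splits into the sums over disjoint subsets and over the uncovered part. -/
theorem sum_eq_uncovered_add {β : Type*} [AddCommMonoid β] {X : Finset (Fin m)}
    {P : Finset (Finset (Fin m))} (hP : ∀ F ∈ P, F ⊆ X)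
    (hd : ∀ F ∈ P, ∀ G ∈ P, F ≠ G → Disjoint F G) (f : Fin m → β) :
    ∑ v ∈ X, f v = ∑ v ∈ X with ∀ F ∈ P, v ∉ F, f v + ∑ F ∈ P, ∑ v ∈ F, f v := by
  classical
  have h1 : ∑ v ∈ P.biUnion id, f v = ∑ F ∈ P, ∑ v ∈ F, f v :=
    Finset.sum_biUnion (t := id) (fun F hF G hG h => hd F hF G hG h)
  have h2 : X.filter (fun v => ¬ ∀ F ∈ P, v ∉ F) = P.biUnion id := by
    ext v
    simp only [Finset.mem_filter, Finset.mem_biUnion, id]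
    constructor
    · rintro ⟨-, h⟩
      push Not at h
      exact h
    · rintro ⟨F, hF, hv⟩
      exact ⟨hP F hF hv, fun h => h F hF hv⟩
  rw [← h1, ← h2, Finset.sum_filter_add_sum_filter_not]

theorem card_eq_uncovered_add {X : Finset (Fin m)} {P : Finset (Finset (Fin m))}
    (hP : ∀ F ∈ P, F.card = k ∧ F ⊆ X) (hd : ∀ F ∈ P, ∀ G ∈ P, F ≠ G → Disjoint F G) :
    X.card = (X.filter (fun v => ∀ F ∈ P, v ∉ F)).card + P.card * k := by
  have h := sum_eq_uncovered_add (fun F hF => (hP F hF).2) hd (fun _ => 1)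
  rw [← Finset.card_eq_sum_ones, ← Finset.card_eq_sum_ones] at h
  rw [h, Finset.sum_const_nat fun F hF => (Finset.card_eq_sum_ones F).symm.trans (hP F hF).1]

theorem exists_isPacking (hk : 0 < k) (X : Finset (Fin m)) : ∃ P, IsPacking k X P := by
  classical
  induction X using Finset.strongInduction with
  | H X ih =>
    by_cases hX : X.card < k
    · exact ⟨∅, by simp, by simp, by simpa using hX⟩
    · obtain ⟨F, hFX, hF⟩ := Finset.exists_subset_card_eq (not_lt.mp hX)
      have hF0 : F.Nonempty := Finset.card_pos.mp (hF ▸ hk)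
      obtain ⟨P, hP, hd, hc⟩ := ih (X \ F) (Finset.sdiff_ssubset hFX hF0)
      have hdF : ∀ G ∈ P, Disjoint F G := fun G hG =>
        Finset.disjoint_of_subset_right (hP G hG).2 Finset.disjoint_sdiff
      refine ⟨insert F P, ?_, ?_, ?_⟩
      · intro G hG
        rcases Finset.mem_insert.mp hG with rfl | hG
        · exact ⟨hF, hFX⟩
        · exact ⟨(hP G hG).1, (hP G hG).2.trans Finset.sdiff_subset⟩
      · intro G hG H hH hne
        rcases Finset.mem_insert.mp hG with rfl | hG' <;>
          rcases Finset.mem_insert.mp hH with rfl | hH'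
        · exact absurd rfl hne
        · exact hdF _ hH'
        · exact (hdF _ hG').symm
        · exact hd _ hG' _ hH' hne
      · convert hc using 2
        ext v
        simp only [Finset.mem_filter, Finset.mem_insert, forall_eq_or_imp, Finset.mem_sdiff]
        tauto

/-! ### Existence of schedules -/

theorem exists_isSchedule (hk : 0 < k) (hkm : k ∣ m) (σ : Inst χ m) :
    ∃ M t, IsSchedule k σ M t := by
  obtain ⟨P, hP, hd, hc⟩ := exists_isPacking hk (Finset.univ : Finset (Fin m))
  have h := card_eq_uncovered_add hP hd
  rw [Finset.card_univ, Fintype.card_fin] at h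
  have h0 : (Finset.univ.filter (fun v : Fin m => ∀ F ∈ P, v ∉ F)).card = 0 := by
    refine Nat.eq_zero_of_dvd_of_lt ?_ hc
    exact (Nat.dvd_add_left (Dvd.intro_left _ rfl)).mp (h ▸ hkm)
  refine ⟨P, fun _ => ∑ v, σ.atime v, ⟨fun F hF => (hP F hF).1, hd, fun v => ?_⟩, fun F _ v _ => ?_⟩
  · by_contra! hv
    have : v ∈ Finset.univ.filter (fun v : Fin m => ∀ F ∈ P, v ∉ F) := by simpa using hv
    rw [Finset.card_eq_zero.mp h0] at this
    simp at this
  · exact Finset.single_le_sum (f := σ.atime) (fun v _ => σ.atime_nonneg v) (Finset.mem_univ v)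

/-! ### The metric `dMax` -/

section dMax

variable [MetricSpace χ]

theorem dist_le_dMax (p : Fin k → χ) (i j : Fin k) : dist (p i) (p j) ≤ dMax k p :=
  le_ciSup (f := fun ij : Fin k × Fin k => dist (p ij.1) (p ij.2)) (Set.finite_range _).bddAbove
    (i, j)

theorem dMax_le {p : Fin k → χ} {C : ℝ} (hC : 0 ≤ C) (h : ∀ i j, dist (p i) (p j) ≤ C) :
    dMax k p ≤ C :=
  Real.iSup_le (fun ij => h ij.1 ij.2) hC

theorem dMax_nonneg (p : Fin k → χ) : 0 ≤ dMax k p :=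
  Real.iSup_nonneg (fun _ => dist_nonneg)

theorem dMax_one_other (hk : 2 ≤ k) (p q : χ) :
    dMax k (fun i => if (i : ℕ) = 0 then p else q) = dist p q := by
  apply le_antisymm
  · refine dMax_le dist_nonneg (fun i j => ?_)
    split_ifs <;> simp [dist_comm]
  · simpa using dist_le_dMax (k := k) (fun i => if (i : ℕ) = 0 then p else q)
      ⟨0, by omega⟩ ⟨1, by omega⟩

theorem pairDist_dMax (hk : 2 ≤ k) (p q : χ) : pairDist (dMax k) p q = 2 * dist p q := by
  rw [pairDist, dMax_one_other hk, dMax_one_other hk, dist_comm q p, two_mul]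

theorem edgeCost_dMax (hk : 2 ≤ k) (σ : Inst χ m) (u v : Fin m) :
    edgeCost (dMax k) σ u v = 2 * dist (σ.pos u) (σ.pos v) + |σ.atime u - σ.atime v| := by
  rw [edgeCost, pairDist_dMax hk]

theorem groupDist_nonneg (σ : Inst χ m) (F : Finset (Fin m)) : 0 ≤ groupDist (dMax k) σ F := by
  unfold groupDist
  split_ifs
  · exact dMax_nonneg _
  · exact le_rfl

theorem dist_le_groupDist (σ : Inst χ m) {F : Finset (Fin m)} (hF : F.card = k) {u v : Fin m}
    (hu : u ∈ F) (hv : v ∈ F) : dist (σ.pos u) (σ.pos v) ≤ groupDist (dMax k) σ F := by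
  obtain ⟨i, hi⟩ := (F.orderIsoOfFin hF).surjective ⟨u, hu⟩
  obtain ⟨j, hj⟩ := (F.orderIsoOfFin hF).surjective ⟨v, hv⟩
  have h := dist_le_dMax (fun i => σ.pos (F.orderEmbOfFin hF i)) i j
  rw [← Finset.coe_orderIsoOfFin_apply, ← Finset.coe_orderIsoOfFin_apply, hi, hj] at h
  rwa [groupDist, dif_pos hF]

theorem groupDist_le (σ : Inst χ m) {F : Finset (Fin m)} {C : ℝ} (hC : 0 ≤ C)
    (h : ∀ u ∈ F, ∀ v ∈ F, dist (σ.pos u) (σ.pos v) ≤ C) : groupDist (dMax k) σ F ≤ C := by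
  unfold groupDist
  split_ifs with hF
  · exact dMax_le hC (fun i j => h _ (F.orderEmbOfFin_mem hF i) _ (F.orderEmbOfFin_mem hF j))
  · exact hC

end dMax

/-! ### Weak duality -/

theorem mod_mul_sub_mod_add_le {a : ℕ} (ha : a ≤ k) (n : ℕ) (hk : 0 < k) :
    (((a + n) % k : ℕ) : ℝ) * ((k : ℝ) - ((a + n) % k : ℕ))
      ≤ (a : ℝ) * ((k : ℝ) - a) + ((n % k : ℕ) : ℝ) * ((k : ℝ) - (n % k : ℕ)) := by
  have hs : n % k < k := Nat.mod_lt _ hk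
  have hmod : (a + n) % k = (a + n % k) % k := by simp
  rw [hmod]
  generalize n % k = b at hs
  have ha' : (a : ℝ) ≤ k := by exact_mod_cast ha
  have hb' : (b : ℝ) ≤ k := by exact_mod_cast hs.le
  rcases lt_or_ge (a + b) k with h | h
  · rw [Nat.mod_eq_of_lt h]
    push_cast
    nlinarith [mul_nonneg (Nat.cast_nonneg (α := ℝ) a) (Nat.cast_nonneg (α := ℝ) b)]
  · rw [Nat.mod_eq_sub_mod h, Nat.mod_eq_of_lt (by omega), Nat.cast_sub h]
    push_cast
    nlinarith [mul_nonneg (sub_nonneg.mpr ha') (sub_nonneg.mpr hb')]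

theorem mod_sum_mul_sub_le {ι : Type*} (M : Finset ι) (a : ι → ℕ) (ha : ∀ i ∈ M, a i ≤ k)
    (hk : 0 < k) :
    (((∑ i ∈ M, a i) % k : ℕ) : ℝ) * ((k : ℝ) - ((∑ i ∈ M, a i) % k : ℕ))
      ≤ ∑ i ∈ M, (a i : ℝ) * ((k : ℝ) - a i) := by
  classical
  induction M using Finset.induction_on with
  | empty => simp
  | insert i M hi ih =>
    rw [Finset.sum_insert hi, Finset.sum_insert hi]
    refine (mod_mul_sub_mod_add_le (ha i (Finset.mem_insert_self i M)) _ hk).trans ?_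
    gcongr
    exact ih (fun j hj => ha j (Finset.mem_insert_of_mem hj))

theorem sum_sum_cutSum (y : Finset (Fin m) → ℝ) {F : Finset (Fin m)} (hF : F.card = k) :
    ∑ u ∈ F, ∑ v ∈ F, cutSum y u v
      = ∑ S, 2 * (((S ∩ F).card : ℝ) * ((k : ℝ) - (S ∩ F).card)) * y S := by
  have h1 : ∀ u v, cutSum y u v = ∑ S, ((if u ∈ S then (1 : ℝ) else 0) * (1 - if v ∈ S then 1 else 0)
      + (1 - if u ∈ S then 1 else 0) * (if v ∈ S then (1 : ℝ) else 0)) * y S := by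
    intro u v
    rw [cutSum, Finset.sum_filter]
    refine Finset.sum_congr rfl (fun S _ => ?_)
    by_cases hu : u ∈ S <;> by_cases hv : v ∈ S <;> simp [hu, hv]
  simp only [h1]
  rw [Finset.sum_congr rfl (fun u _ => Finset.sum_comm), Finset.sum_comm]
  refine Finset.sum_congr rfl (fun S _ => ?_)
  have h2 : ∑ u ∈ F, (if u ∈ S then (1 : ℝ) else 0) = (S ∩ F).card := by
    rw [← Finset.sum_filter, Finset.sum_const, nsmul_eq_mul, mul_one, Finset.filter_mem_eq_inter,
      Finset.inter_comm]
  have h3 : ∑ u ∈ F, (1 - if u ∈ S then (1 : ℝ) else 0) = k - (S ∩ F).card := by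
    rw [Finset.sum_sub_distrib, h2, Finset.sum_const, hF, nsmul_eq_mul, mul_one]
  simp only [← Finset.sum_mul, Finset.sum_add_distrib, ← Finset.mul_sum, h2, h3]
  ring

theorem sur_mul_le_sum {M : Finset (Finset (Fin m))} (hk : 0 < k) (hM : IsPerfectMatching k M)
    (S : Finset (Fin m)) :
    (sur k S : ℝ) * ((k : ℝ) - sur k S)
      ≤ ∑ F ∈ M, ((S ∩ F).card : ℝ) * ((k : ℝ) - (S ∩ F).card) := by
  have hS : S.card = ∑ F ∈ M, (S ∩ F).card := by
    rw [← Finset.card_biUnion]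
    · congr 1
      ext v
      simp only [Finset.mem_biUnion, Finset.mem_inter]
      exact ⟨fun h => (hM.2.2 v).imp fun F hF => ⟨hF.1, h, hF.2⟩, fun ⟨F, _, h, _⟩ => h⟩
    · intro F hF G hG hne
      exact (hM.2.1 F hF G hG hne).mono Finset.inter_subset_right Finset.inter_subset_right
  rw [sur, hS]
  exact mod_sum_mul_sub_le M _
    (fun F hF => (Finset.card_le_card Finset.inter_subset_right).trans (hM.1 F hF).le) hk

theorem rate_one (k : ℕ) : rate k 1 = 1 / (k : ℝ) ^ 2 := by simp [rate]

theorem cutSum_self (y : Finset (Fin m) → ℝ) (u : Fin m) : cutSum y u u = 0 := by simp [cutSum]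

section duality

variable [MetricSpace χ]

theorem sum_sum_cutSum_le (hk : 2 ≤ k) {σ : Inst χ m} {y : Finset (Fin m) → ℝ}
    (hy : DualFeasible (dMax k) 1 σ y) {F : Finset (Fin m)} (hF : F.card = k) {t : ℝ}
    (ht : ∀ v ∈ F, σ.atime v ≤ t) :
    ∑ u ∈ F, ∑ v ∈ F, cutSum y u v
      ≤ 2 * (groupDist (dMax k) σ F + ∑ v ∈ F, (t - σ.atime v)) := by
  have hk0 : (0 : ℝ) < k := by exact_mod_cast (by omega : 0 < k)
  have hk1 : (1 : ℝ) ≤ k := by exact_mod_cast (by omega : 1 ≤ k)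
  set D := groupDist (dMax k) σ F with hD
  have hD0 : 0 ≤ D := groupDist_nonneg σ F
  set W := ∑ v ∈ F, (t - σ.atime v) with hW
  have hW0 : 0 ≤ W := Finset.sum_nonneg (fun v hv => sub_nonneg.mpr (ht v hv))
  have hpair : ∀ u ∈ F, ∀ v ∈ F,
      cutSum y u v ≤ 1 / (k : ℝ) ^ 2 * (2 * D + ((t - σ.atime u) + (t - σ.atime v))) := by
    intro u hu v hv
    have hu' := ht u hu
    have hv' := ht v hv
    by_cases huv : u = v
    · subst huv
      rw [cutSum_self]
      have : 0 ≤ 2 * D + ((t - σ.atime u) + (t - σ.atime u)) := by linarith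
      positivity
    · refine (hy.2 u v huv).trans ?_
      rw [rate_one, edgeCost_dMax hk]
      have h1 := dist_le_groupDist σ hF hu hv
      have h2 : |σ.atime u - σ.atime v| ≤ (t - σ.atime u) + (t - σ.atime v) :=
        abs_le.mpr ⟨by linarith, by linarith⟩
      gcongr
  calc ∑ u ∈ F, ∑ v ∈ F, cutSum y u v
      ≤ ∑ u ∈ F, ∑ v ∈ F, 1 / (k : ℝ) ^ 2 * (2 * D + ((t - σ.atime u) + (t - σ.atime v))) :=
        Finset.sum_le_sum fun u hu => Finset.sum_le_sum fun v hv => hpair u hu v hv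
    _ = 1 / (k : ℝ) ^ 2 * (k * (k * (2 * D)) + (k * W + k * W)) := by
        simp only [← Finset.mul_sum, Finset.sum_add_distrib, Finset.sum_const, hF, nsmul_eq_mul,
          ← hW]
        ring
    _ = 2 * D + 2 * W / k := by field_simp; ring
    _ ≤ 2 * D + 2 * W := by gcongr; exact div_le_self (by linarith) hk1
    _ = _ := by ring

/-- Weak duality. -/
theorem dualObjective_le_cost (hk : 2 ≤ k) {σ : Inst χ m} {y : Finset (Fin m) → ℝ}
    (hy : DualFeasible (dMax k) 1 σ y) {M : Finset (Finset (Fin m))} {t : Finset (Fin m) → ℝ}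
    (hM : IsSchedule k σ M t) : dualObjective k y ≤ cost (dMax k) σ M t := by
  have h1 : 2 * dualObjective k y ≤ ∑ F ∈ M, ∑ u ∈ F, ∑ v ∈ F, cutSum y u v := by
    rw [Finset.sum_congr rfl (fun F hF => sum_sum_cutSum y (hM.1.1 F hF)), Finset.sum_comm,
      dualObjective, Finset.mul_sum]
    refine Finset.sum_le_sum (fun S _ => ?_)
    rw [← Finset.sum_mul, ← Finset.mul_sum, ← mul_assoc]
    exact mul_le_mul_of_nonneg_right
      (mul_le_mul_of_nonneg_left (sur_mul_le_sum (by omega) hM.1 S) zero_le_two) (hy.1 S)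
  have h2 : ∑ F ∈ M, ∑ u ∈ F, ∑ v ∈ F, cutSum y u v ≤ 2 * cost (dMax k) σ M t := by
    rw [cost, Finset.mul_sum]
    exact Finset.sum_le_sum fun F hF => sum_sum_cutSum_le hk hy (hM.1.1 F hF) (hM.2 F hF)
  linarith

theorem dualFeasible_zero (hk : 2 ≤ k) (σ : Inst χ m) :
    DualFeasible (dMax k) 1 σ (fun _ => 0) := by
  refine ⟨fun _ => le_rfl, fun u v _ => ?_⟩
  rw [rate_one, edgeCost_dMax hk, cutSum, Finset.sum_const_zero]
  positivity

theorem isLUB_dualOpt (hk : 2 ≤ k) (hkm : k ∣ m) (σ : Inst χ m) :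
    IsLUB (dualValues (dMax k) 1 σ) (dualOpt (dMax k) 1 σ) := by
  obtain ⟨M, t, hM⟩ := exists_isSchedule (by omega) hkm σ
  refine isLUB_csSup ⟨_, _, dualFeasible_zero hk σ, rfl⟩ ⟨cost (dMax k) σ M t, ?_⟩
  rintro _ ⟨y, hy, rfl⟩
  exact dualObjective_le_cost hk hy hM

theorem dualOpt_le_opt (hk : 2 ≤ k) (hkm : k ∣ m) (σ : Inst χ m) :
    dualOpt (dMax k) 1 σ ≤ opt (dMax k) σ := by
  obtain ⟨M, t, hM⟩ := exists_isSchedule (by omega) hkm σ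
  refine le_csInf ⟨_, M, t, hM, rfl⟩ ?_
  rintro _ ⟨M, t, hM, rfl⟩
  refine (isLUB_dualOpt hk hkm σ).2 ?_
  rintro _ ⟨y, hy, rfl⟩
  exact dualObjective_le_cost hk hy hM

end duality

/-! ### Termination -/

theorem grow_zero (s : State m) (r : ℝ) : s.grow r 0 = s := by
  simp [State.grow]

theorem ite_zero_one_le (p : Prop) [Decidable p] : (if p then 0 else 1) ≤ 1 := by
  split_ifs <;> omega

/-- A bound on the number of steps of the algorithm after the state `s`. -/
noncomputable def potential [MetricSpace χ] (k : ℕ) (σ : Inst χ m) (s : State m) : ℕ :=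
  open Classical in
  4 * (m - s.arrived) + 2 * s.active.card + if Event (dMax k) 1 σ s then 0 else 1

theorem potential_lt [MetricSpace χ] {σ : Inst χ m} {s s' : State m}
    (h : Step (dMax k) 1 σ s s') : potential k σ s' < potential k σ s := by
  classical
  unfold potential
  cases h with
  | arrive v hv =>
    have h1 : (v : ℕ) = s.arrived := hv.1
    have h2 := v.isLt
    have h3 := Finset.card_insert_le {v} s.active
    simp only [State.arrive]
    have h4 := ite_zero_one_le (Event (dMax k) 1 σ (s.arrive v))
    simp only [State.arrive] at h4
    omega
  | merge A B u v P hT hP =>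
    have hB : B ∈ s.active.erase A := Finset.mem_erase.mpr ⟨hT.2.2.1.symm, hT.2.1⟩
    have h3 := Finset.card_insert_le (A ∪ B) ((s.active.erase A).erase B)
    have h4 := Finset.card_erase_add_one hB
    have h5 := Finset.card_erase_add_one hT.1
    simp only [State.merge]
    have h6 := ite_zero_one_le (Event (dMax k) 1 σ (s.merge A B u v P))
    simp only [State.merge] at h6
    omega
  | wait δ hδ hbefore hat =>
    have h0 := hbefore 0 le_rfl hδ
    rw [grow_zero] at h0
    rw [if_neg h0, if_pos hat]
    simp only [State.grow]
    omega

theorem not_exists_infinite_execution [MetricSpace χ] (k : ℕ) (σ : Inst χ m) :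
    ¬ ∃ f : ℕ → State m, f 0 = State.start m ∧ ∀ n, Step (dMax k) 1 σ (f n) (f (n + 1)) := by
  rintro ⟨f, -, hf⟩
  obtain ⟨n, hn⟩ := WellFounded.has_min (wellFounded_lt (α := ℕ))
    (Set.range fun n => potential k σ (f n)) ⟨_, 0, rfl⟩
  obtain ⟨⟨i, rfl⟩, hmin⟩ := hn
  exact hmin _ ⟨i + 1, rfl⟩ (potential_lt (hf i))

/-! ### Linear functionals of the dual variables -/

/-- The sum of `y_S` over the sets `S` that contain `v`. -/
noncomputable def load (y : Finset (Fin m) → ℝ) (v : Fin m) : ℝ :=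
  ∑ S : Finset (Fin m) with v ∈ S, y S

theorem load_add_mul (y z : Finset (Fin m) → ℝ) (a : ℝ) (v : Fin m) :
    load (fun S => y S + a * z S) v = load y v + a * load z v := by
  simp only [load, Finset.sum_add_distrib, Finset.mul_sum]

theorem cutSum_add_mul (y z : Finset (Fin m) → ℝ) (a : ℝ) (u v : Fin m) :
    cutSum (fun S => y S + a * z S) u v = cutSum y u v + a * cutSum z u v := by
  simp only [cutSum, Finset.sum_add_distrib, Finset.mul_sum]

theorem dualObjective_add_mul (y z : Finset (Fin m) → ℝ) (a : ℝ) :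
    dualObjective k (fun S => y S + a * z S) = dualObjective k y + a * dualObjective k z := by
  simp only [dualObjective, Finset.mul_sum, ← Finset.sum_add_distrib]
  exact Finset.sum_congr rfl fun S _ => by ring

theorem cutSum_comm (y : Finset (Fin m) → ℝ) (u v : Fin m) : cutSum y u v = cutSum y v u := by
  simp only [cutSum, iff_comm]

theorem cutSum_le_load {y : Finset (Fin m) → ℝ} (hy : ∀ S, 0 ≤ y S) (u v : Fin m) :
    cutSum y u v ≤ load y u + load y v := by
  simp only [cutSum, load, Finset.sum_filter, ← Finset.sum_add_distrib]
  refine Finset.sum_le_sum fun S _ => ?_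
  have := hy S
  by_cases hu : u ∈ S <;> by_cases hv : v ∈ S <;> simp [hu, hv, this]

theorem sur_lt (hk : 0 < k) (S : Finset (Fin m)) : sur k S < k := Nat.mod_lt _ hk

theorem sur_le_mul (hk : 0 < k) (S : Finset (Fin m)) :
    (sur k S : ℝ) ≤ (sur k S : ℝ) * ((k : ℝ) - sur k S) := by
  have h : (sur k S : ℝ) + 1 ≤ k := by exact_mod_cast sur_lt hk S
  exact le_mul_of_one_le_right (Nat.cast_nonneg _) (by linarith)

theorem sub_one_mul_sum_le_dualObjective (hk : 0 < k) {y : Finset (Fin m) → ℝ} (hy : ∀ S, 0 ≤ y S)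
    (hs : ∀ S, y S ≠ 0 → sur k S ≠ 0) : ((k : ℝ) - 1) * ∑ S, y S ≤ dualObjective k y := by
  rw [dualObjective, Finset.mul_sum]
  refine Finset.sum_le_sum fun S _ => ?_
  by_cases h : y S = 0
  · simp [h]
  · have h1 : (1 : ℝ) ≤ sur k S := by exact_mod_cast Nat.one_le_iff_ne_zero.mpr (hs S h)
    have h2 : (sur k S : ℝ) + 1 ≤ k := by exact_mod_cast sur_lt hk S
    exact mul_le_mul_of_nonneg_right (by nlinarith) (hy S)

/-! ### The steps of the algorithm -/

namespace State

/-- The indicator function of the active sets that contain a free request. -/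
noncomputable def growing (s : State m) (S : Finset (Fin m)) : ℝ :=
  if S ∈ s.active ∧ (s.free S).Nonempty then 1 else 0

theorem growing_nonneg (s : State m) (S : Finset (Fin m)) : 0 ≤ s.growing S := by
  unfold growing; split_ifs <;> norm_num

theorem growing_le_one (s : State m) (S : Finset (Fin m)) : s.growing S ≤ 1 := by
  unfold growing; split_ifs <;> norm_num

theorem growing_ne_zero {s : State m} {S : Finset (Fin m)} (h : s.growing S ≠ 0) :
    S ∈ s.active ∧ (s.free S).Nonempty := by
  unfold growing at h
  exact of_not_not fun h' => h (if_neg h')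

theorem grow_y (s : State m) (r δ : ℝ) :
    (s.grow r δ).y = fun S => s.y S + r * δ * s.growing S := by
  funext S
  simp only [grow, growing]
  split_ifs <;> simp

/-- The requests that have arrived and are not yet matched. -/
def waiting (s : State m) : Finset (Fin m) :=
  Finset.univ.filter (fun v => (v : ℕ) < s.arrived ∧ ∀ F ∈ s.matching, v ∉ F)

theorem mem_waiting {s : State m} {v : Fin m} :
    v ∈ s.waiting ↔ (v : ℕ) < s.arrived ∧ ∀ F ∈ s.matching, v ∉ F := by
  simp [waiting]

theorem mem_free {s : State m} {S : Finset (Fin m)} {v : Fin m} :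
    v ∈ s.free S ↔ v ∈ S ∧ ∀ F ∈ s.matching, v ∉ F := by
  simp [free]

theorem merge_free (s : State m) (A B : Finset (Fin m)) (u v : Fin m)
    (P : Finset (Finset (Fin m))) (C : Finset (Fin m)) :
    (s.merge A B u v P).free C = (s.free C).filter (fun v => ∀ F ∈ P, v ∉ F) := by
  ext w
  simp only [free, merge, Finset.mem_filter, Finset.mem_union, or_imp, forall_and, and_assoc]

theorem merge_waiting (s : State m) (A B : Finset (Fin m)) (u v : Fin m)
    (P : Finset (Finset (Fin m))) :
    (s.merge A B u v P).waiting = s.waiting.filter (fun v => ∀ F ∈ P, v ∉ F) := by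
  ext w
  simp only [waiting, merge, Finset.mem_filter, Finset.mem_union, or_imp, forall_and, and_assoc]

end State

/-- What holds in every state that the algorithm can reach. -/
structure Invariant [MetricSpace χ] (k : ℕ) (σ : Inst χ m) (s : State m) : Prop where
  arrived_le : s.arrived ≤ m
  atime_le : ∀ v : Fin m, (v : ℕ) < s.arrived → σ.atime v ≤ s.time
  le_atime : ∀ v : Fin m, s.arrived ≤ v → s.time ≤ σ.atime v
  lt_arrived : ∀ A ∈ s.active, ∀ v ∈ A, (v : ℕ) < s.arrived
  active_unique : ∀ A ∈ s.active, ∀ B ∈ s.active, ∀ v, v ∈ A → v ∈ B → A = B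
  exists_active : ∀ v : Fin m, (v : ℕ) < s.arrived → ∃ A ∈ s.active, v ∈ A
  card_free : ∀ A ∈ s.active, (s.free A).card = sur k A
  matching_lt : ∀ F ∈ s.matching, ∀ v ∈ F, (v : ℕ) < s.arrived
  matching_card : ∀ F ∈ s.matching, F.card = k
  matching_disjoint : ∀ F ∈ s.matching, ∀ G ∈ s.matching, F ≠ G → Disjoint F G
  atime_le_mtime : ∀ F ∈ s.matching, ∀ v ∈ F, σ.atime v ≤ s.mtime F
  y_nonneg : ∀ S, 0 ≤ s.y S
  subset_active : ∀ S, s.y S ≠ 0 → ∃ A ∈ s.active, S ⊆ A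
  sur_ne_zero : ∀ S, s.y S ≠ 0 → sur k S ≠ 0
  load_le : ∀ v : Fin m, (v : ℕ) < s.arrived → load s.y v ≤ rate k 1 * (s.time - σ.atime v)
  cutSum_le : ∀ u v : Fin m, (u : ℕ) < s.arrived → (v : ℕ) < s.arrived → u ≠ v →
    cutSum s.y u v ≤ rate k 1 * edgeCost (dMax k) σ u v
  dist_le : ∀ A ∈ s.active, ∀ u ∈ A, ∀ v ∈ A,
    dist (σ.pos u) (σ.pos v) + (k : ℝ) ^ 2 / 2 * (load s.y u + load s.y v)
      ≤ (k : ℝ) ^ 2 * ∑ S ∈ A.powerset, s.y S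
  groupDist_le : ∀ F ∈ s.matching, groupDist (dMax k) σ F ≤ (k : ℝ) ^ 2 * ∑ S, s.y S
  waiting_le : ∑ F ∈ s.matching, ∑ v ∈ F, (s.mtime F - σ.atime v)
      + ∑ v ∈ s.waiting, (s.time - σ.atime v) ≤ (k : ℝ) ^ 2 * dualObjective k s.y

namespace Invariant

variable [MetricSpace χ] {σ : Inst χ m} {s : State m}

theorem start (k : ℕ) (σ : Inst χ m) : Invariant k σ (State.start m) where
  arrived_le := Nat.zero_le _
  atime_le v hv := absurd hv (Nat.not_lt_zero _)
  le_atime v _ := σ.atime_nonneg v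
  lt_arrived A hA := by simp [State.start] at hA
  active_unique A hA := by simp [State.start] at hA
  exists_active v hv := absurd hv (Nat.not_lt_zero _)
  card_free A hA := by simp [State.start] at hA
  matching_lt F hF := by simp [State.start] at hF
  matching_card F hF := by simp [State.start] at hF
  matching_disjoint F hF := by simp [State.start] at hF
  atime_le_mtime F hF := by simp [State.start] at hF
  y_nonneg S := le_rfl
  subset_active S hS := absurd rfl hS
  sur_ne_zero S hS := absurd rfl hS
  load_le v hv := absurd hv (Nat.not_lt_zero _)
  cutSum_le u v hu := absurd hu (Nat.not_lt_zero _)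
  dist_le A hA := by simp [State.start] at hA
  groupDist_le F hF := by simp [State.start] at hF
  waiting_le := by simp [State.start, State.waiting, dualObjective]

theorem y_eq_zero (h : Invariant k σ s) {v : Fin m} (hv : s.arrived ≤ v) {S : Finset (Fin m)}
    (hS : v ∈ S) : s.y S = 0 := by
  by_contra hne
  obtain ⟨A, hA, hSA⟩ := h.subset_active S hne
  exact absurd (h.lt_arrived A hA v (hSA hS)) (not_lt.mpr hv)

theorem load_eq_zero (h : Invariant k σ s) {v : Fin m} (hv : s.arrived ≤ v) : load s.y v = 0 :=
  Finset.sum_eq_zero fun _ hS => h.y_eq_zero hv (Finset.mem_filter.mp hS).2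

theorem arrive_y (h : Invariant k σ s) {v : Fin m} (hv : s.arrived ≤ v) :
    (s.arrive v).y = s.y := by
  funext S
  simp only [State.arrive]
  split_ifs with hS
  · exact (h.y_eq_zero hv hS).symm
  · rfl

theorem not_mem_matching (h : Invariant k σ s) {v : Fin m} (hv : s.arrived ≤ v) :
    ∀ F ∈ s.matching, v ∉ F :=
  fun F hF hvF => absurd (h.matching_lt F hF v hvF) (not_lt.mpr hv)

theorem arrive (hk : 2 ≤ k) (h : Invariant k σ s) {v : Fin m} (hv : ArrivesNow σ s v) :
    Invariant k σ (s.arrive v) := by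
  have hva : s.arrived ≤ v := hv.1.ge
  have hy := h.arrive_y hva
  have hlt : ∀ u : Fin m, (u : ℕ) < s.arrived + 1 → (u : ℕ) < s.arrived ∨ u = v := fun u hu =>
    (Nat.lt_succ_iff_lt_or_eq.mp hu).imp_right fun e => Fin.ext (e.trans hv.1.symm)
  have hlv : load s.y v = 0 := h.load_eq_zero hva
  have hr : 0 ≤ rate k 1 := by rw [rate_one]; positivity
  have hcut : ∀ u : Fin m, (u : ℕ) < s.arrived →
      cutSum s.y u v ≤ rate k 1 * (2 * dist (σ.pos u) (σ.pos v) + |σ.atime u - σ.atime v|) := by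
    intro u hu
    have h1 := cutSum_le_load h.y_nonneg u v
    have h2 := h.load_le u hu
    have h3 : s.time - σ.atime u ≤ 2 * dist (σ.pos u) (σ.pos v) + |σ.atime u - σ.atime v| := by
      rw [← hv.2, abs_sub_comm]
      have := le_abs_self (σ.atime v - σ.atime u)
      have := dist_nonneg (x := σ.pos u) (y := σ.pos v)
      linarith
    have h4 := mul_le_mul_of_nonneg_left h3 hr
    linarith
  constructor
  · exact Nat.succ_le_of_lt (hv.1 ▸ v.isLt)
  · intro u hu
    rcases hlt u hu with hu | rfl
    · exact h.atime_le u hu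
    · exact hv.2.le
  · exact fun u hu => h.le_atime u ((Nat.le_succ _).trans hu)
  · intro A hA u hu
    rcases Finset.mem_insert.mp hA with rfl | hA
    · rw [Finset.mem_singleton.mp hu]
      exact Nat.lt_succ_of_le hv.1.le
    · exact Nat.lt_succ_of_lt (h.lt_arrived A hA u hu)
  · have hnew : ∀ A ∈ s.active, v ∉ A := fun A hA hvA =>
      absurd (h.lt_arrived A hA v hvA) (not_lt.mpr hva)
    intro A hA B hB u huA huB
    rcases Finset.mem_insert.mp hA with rfl | hA' <;> rcases Finset.mem_insert.mp hB with rfl | hB'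
    · rfl
    · exact absurd (Finset.mem_singleton.mp huA ▸ huB) (hnew B hB')
    · exact absurd (Finset.mem_singleton.mp huB ▸ huA) (hnew A hA')
    · exact h.active_unique A hA' B hB' u huA huB
  · intro u hu
    rcases hlt u hu with hu | rfl
    · obtain ⟨A, hA, huA⟩ := h.exists_active u hu
      exact ⟨A, Finset.mem_insert_of_mem hA, huA⟩
    · exact ⟨{u}, Finset.mem_insert_self _ _, Finset.mem_singleton_self u⟩
  · intro A hA
    rcases Finset.mem_insert.mp hA with rfl | hA
    · have : (s.arrive v).free {v} = {v} := by
        rw [State.free, Finset.filter_eq_self]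
        intro u hu
        rw [Finset.mem_singleton.mp hu]
        exact h.not_mem_matching hva
      rw [this, sur, Finset.card_singleton, Nat.mod_eq_of_lt (by omega)]
    · exact h.card_free A hA
  · exact fun F hF u hu => Nat.lt_succ_of_lt (h.matching_lt F hF u hu)
  · exact h.matching_card
  · exact h.matching_disjoint
  · exact h.atime_le_mtime
  · rw [hy]
    exact h.y_nonneg
  · intro S hS
    rw [hy] at hS
    obtain ⟨A, hA, hSA⟩ := h.subset_active S hS
    exact ⟨A, Finset.mem_insert_of_mem hA, hSA⟩
  · rw [hy]
    exact h.sur_ne_zero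
  · intro u hu
    rw [hy]
    rcases hlt u hu with hu | rfl
    · exact h.load_le u hu
    · rw [hlv, hv.2]
      simp [State.arrive]
  · intro u w hu hw hne
    rw [hy]
    rcases hlt u hu with hu' | rfl <;> rcases hlt w hw with hw' | rfl
    · exact h.cutSum_le u w hu' hw' hne
    · rw [edgeCost_dMax hk]
      exact hcut u hu'
    · rw [edgeCost_dMax hk, cutSum_comm, dist_comm, abs_sub_comm]
      exact hcut w hw'
    · exact absurd rfl hne
  · intro A hA u hu w hw
    rw [hy]
    rcases Finset.mem_insert.mp hA with rfl | hA
    · rw [Finset.mem_singleton.mp hu, Finset.mem_singleton.mp hw, hlv, dist_self]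
      have := Finset.sum_nonneg fun S (_ : S ∈ Finset.powerset {v}) => h.y_nonneg S
      simp only [add_zero, mul_zero]
      positivity
    · exact h.dist_le A hA u hu w hw
  · rw [hy]
    exact h.groupDist_le
  · have hw : (s.arrive v).waiting = insert v s.waiting := by
      ext u
      simp only [Finset.mem_insert, State.mem_waiting, State.arrive]
      constructor
      · rintro ⟨hu, hF⟩
        rcases hlt u hu with hu | rfl
        · exact Or.inr ⟨hu, hF⟩
        · exact Or.inl rfl
      · rintro (rfl | ⟨hu, hF⟩)
        · exact ⟨Nat.lt_succ_of_le hv.1.le, h.not_mem_matching hva⟩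
        · exact ⟨Nat.lt_succ_of_lt hu, hF⟩
    have hvw : v ∉ s.waiting := fun hvw => absurd (State.mem_waiting.mp hvw).1 (not_lt.mpr hva)
    rw [hy, hw, Finset.sum_insert hvw, hv.2]
    simpa [State.arrive] using h.waiting_le

/-! ### Waiting -/

theorem load_growing (h : Invariant k σ s) {A : Finset (Fin m)} (hA : A ∈ s.active) {u : Fin m}
    (hu : u ∈ A) : load s.growing u = s.growing A := by
  refine Finset.sum_eq_single A (fun S hS hne => ?_) fun hn => absurd hu (by simpa using hn)
  by_contra h0
  exact hne (h.active_unique S (State.growing_ne_zero h0).1 A hA u (Finset.mem_filter.mp hS).2 hu)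

theorem cutSum_growing_eq_zero (h : Invariant k σ s) {A : Finset (Fin m)} (hA : A ∈ s.active)
    {u v : Fin m} (hu : u ∈ A) (hv : v ∈ A) : cutSum s.growing u v = 0 := by
  refine Finset.sum_eq_zero fun S hS => ?_
  by_contra h0
  have hSa := (State.growing_ne_zero h0).1
  refine (Finset.mem_filter.mp hS).2 ⟨fun huS => ?_, fun hvS => ?_⟩
  · rwa [h.active_unique S hSa A hA u huS hu]
  · rwa [h.active_unique S hSa A hA v hvS hv]

theorem waiting_card_le (hk : 0 < k) (h : Invariant k σ s) :
    (s.waiting.card : ℝ) ≤ dualObjective k s.growing := by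
  have h1 : s.waiting ⊆ s.active.biUnion s.free := by
    intro v hv
    obtain ⟨hva, hvF⟩ := State.mem_waiting.mp hv
    obtain ⟨A, hA, hvA⟩ := h.exists_active v hva
    exact Finset.mem_biUnion.mpr ⟨A, hA, State.mem_free.mpr ⟨hvA, hvF⟩⟩
  have h2 : (s.waiting.card : ℝ) ≤ ∑ A ∈ s.active, ((s.free A).card : ℝ) := by
    exact_mod_cast (Finset.card_le_card h1).trans Finset.card_biUnion_le
  refine h2.trans ?_
  rw [dualObjective]
  have hnn : ∀ S, 0 ≤ (sur k S : ℝ) * ((k : ℝ) - sur k S) * s.growing S := fun S =>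
    mul_nonneg ((Nat.cast_nonneg _).trans (sur_le_mul hk S)) (s.growing_nonneg S)
  refine le_trans (Finset.sum_le_sum fun A hA => ?_)
    (Finset.sum_le_sum_of_subset_of_nonneg (Finset.subset_univ s.active) fun S _ _ => hnn S)
  by_cases hne : (s.free A).Nonempty
  · rw [State.growing, if_pos ⟨hA, hne⟩, mul_one, h.card_free A hA]
    exact sur_le_mul hk A
  · rw [Finset.not_nonempty_iff_eq_empty.mp hne, Finset.card_empty, Nat.cast_zero]
    exact hnn A

theorem time_add_le_atime (h : Invariant k σ s) {δ : ℝ}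
    (hbefore : ∀ ε, 0 ≤ ε → ε < δ → ¬ Event (dMax k) 1 σ (s.grow (rate k 1) ε))
    {v : Fin m} (hv : s.arrived ≤ v) : s.time + δ ≤ σ.atime v := by
  have hlt : s.arrived < m := lt_of_le_of_lt hv v.isLt
  refine le_trans ?_ (σ.atime_mono (show (⟨s.arrived, hlt⟩ : Fin m) ≤ v from hv))
  by_contra! hc
  refine hbefore (σ.atime ⟨s.arrived, hlt⟩ - s.time)
    (sub_nonneg.mpr (h.le_atime ⟨s.arrived, hlt⟩ le_rfl)) (by linarith) (Or.inl ⟨⟨s.arrived, hlt⟩, ?_⟩)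
  exact ⟨rfl, by simp [State.grow]⟩

theorem cutSum_add_le (hk : 2 ≤ k) (h : Invariant k σ s) {δ : ℝ} (hδ : 0 < δ)
    (hbefore : ∀ ε, 0 ≤ ε → ε < δ → ¬ Event (dMax k) 1 σ (s.grow (rate k 1) ε))
    {u v : Fin m} (hu : (u : ℕ) < s.arrived) (hv : (v : ℕ) < s.arrived) (huv : u ≠ v) :
    cutSum s.y u v + rate k 1 * δ * cutSum s.growing u v
      ≤ rate k 1 * edgeCost (dMax k) σ u v := by
  have hr : 0 < rate k 1 := by
    have : (0 : ℝ) < k := by exact_mod_cast (by omega : 0 < k)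
    rw [rate_one]; positivity
  have h0 := h.cutSum_le u v hu hv huv
  obtain ⟨A, hA, huA⟩ := h.exists_active u hu
  obtain ⟨B, hB, hvB⟩ := h.exists_active v hv
  by_cases hAB : A = B
  · subst hAB
    rwa [h.cutSum_growing_eq_zero hA huA hvB, mul_zero, add_zero]
  by_contra! hc
  set c := rate k 1 * edgeCost (dMax k) σ u v
  set K := cutSum s.growing u v with hK
  have hK0 : 0 ≤ K := Finset.sum_nonneg fun S _ => s.growing_nonneg S
  have hrK : 0 < rate k 1 * K := by
    by_contra! hle
    nlinarith
  refine hbefore ((c - cutSum s.y u v) / (rate k 1 * K)) (div_nonneg (by linarith) hrK.le) ?_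
    (Or.inr ⟨A, B, u, v, hA, hB, hAB, huA, hvB, ?_⟩)
  · rw [div_lt_iff₀ hrK]
    linarith
  · rw [State.grow_y, cutSum_add_mul, ← hK, mul_right_comm, mul_div_cancel₀ _ hrK.ne']
    ring

theorem grow (hk : 2 ≤ k) (h : Invariant k σ s) {δ : ℝ} (hδ : 0 < δ)
    (hbefore : ∀ ε, 0 ≤ ε → ε < δ → ¬ Event (dMax k) 1 σ (s.grow (rate k 1) ε)) :
    Invariant k σ (s.grow (rate k 1) δ) := by
  have hk0 : (0 : ℝ) < k := by exact_mod_cast (by omega : 0 < k)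
  have hr : 0 < rate k 1 := by rw [rate_one]; positivity
  have hrδ : 0 < rate k 1 * δ := mul_pos hr hδ
  have hkr : (k : ℝ) ^ 2 * (rate k 1 * δ) = δ := by rw [rate_one]; field_simp
  have hy := s.grow_y (rate k 1) δ
  have hyle : ∀ S, s.y S ≤ s.y S + rate k 1 * δ * s.growing S := fun S =>
    le_add_of_nonneg_right (mul_nonneg hrδ.le (s.growing_nonneg S))
  have hne : ∀ S, s.y S + rate k 1 * δ * s.growing S ≠ 0 →
      s.y S ≠ 0 ∨ S ∈ s.active ∧ (s.free S).Nonempty := by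
    intro S hS
    by_contra! hc
    refine hS ?_
    have : s.growing S = 0 := by
      by_contra h0
      obtain ⟨h1, h2⟩ := State.growing_ne_zero h0
      exact h2.ne_empty (hc.2 h1)
    rw [hc.1, this, mul_zero, add_zero]
  constructor
  · exact h.arrived_le
  · exact fun v hv => (h.atime_le v hv).trans (le_add_of_nonneg_right hδ.le)
  · exact fun v hv => h.time_add_le_atime hbefore hv
  · exact h.lt_arrived
  · exact h.active_unique
  · exact h.exists_active
  · exact h.card_free
  · exact h.matching_lt
  · exact h.matching_card
  · exact h.matching_disjoint
  · exact h.atime_le_mtime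
  · rw [hy]
    exact fun S => (h.y_nonneg S).trans (hyle S)
  · intro S hS
    rw [hy] at hS
    rcases hne S hS with h0 | ⟨h1, -⟩
    · exact h.subset_active S h0
    · exact ⟨S, h1, Finset.Subset.rfl⟩
  · intro S hS
    rw [hy] at hS
    rcases hne S hS with h0 | ⟨h1, h2⟩
    · exact h.sur_ne_zero S h0
    · rw [← h.card_free S h1]
      exact h2.card_pos.ne'
  · intro v hv
    obtain ⟨A, hA, hvA⟩ := h.exists_active v hv
    rw [hy, load_add_mul, h.load_growing hA hvA]
    have h1 := h.load_le v hv
    have h2 := mul_le_mul_of_nonneg_left (s.growing_le_one A) hrδ.le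
    simp only [State.grow]
    linarith
  · intro u v hu hv huv
    rw [hy, cutSum_add_mul]
    exact h.cutSum_add_le hk hδ hbefore hu hv huv
  · intro A hA u hu v hv
    rw [hy, load_add_mul, load_add_mul, h.load_growing hA hu, h.load_growing hA hv]
    have h1 := h.dist_le A hA u hu v hv
    have h2 : s.growing A ≤ ∑ S ∈ A.powerset, s.growing S :=
      Finset.single_le_sum (fun S _ => s.growing_nonneg S) (Finset.mem_powerset_self A)
    have h3 := mul_le_mul_of_nonneg_left h2 hδ.le
    rw [Finset.sum_add_distrib, ← Finset.mul_sum]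
    linear_combination h1 + h3 + (s.growing A - ∑ S ∈ A.powerset, s.growing S) * hkr
  · intro F hF
    rw [hy]
    exact (h.groupDist_le F hF).trans (by gcongr with S; exact hyle S)
  · rw [hy, dualObjective_add_mul]
    have h1 := h.waiting_le
    have h2 := mul_le_mul_of_nonneg_left (h.waiting_card_le (by omega)) hδ.le
    have h3 : ∑ v ∈ s.waiting, (s.time + δ - σ.atime v)
        = ∑ v ∈ s.waiting, (s.time - σ.atime v) + s.waiting.card * δ := by
      rw [← nsmul_eq_mul, ← Finset.sum_const, ← Finset.sum_add_distrib]
      exact Finset.sum_congr rfl fun v _ => by ring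
    change ∑ F ∈ s.matching, ∑ v ∈ F, (s.mtime F - σ.atime v)
      + ∑ v ∈ s.waiting, (s.time + δ - σ.atime v) ≤ _
    rw [h3]
    linear_combination h1 + h2 - dualObjective k s.growing * hkr

/-! ### Merging -/

theorem sum_powerset_add_le (h : Invariant k σ s) {A B : Finset (Fin m)} (hAB : Disjoint A B) :
    ∑ S ∈ A.powerset, s.y S + ∑ S ∈ B.powerset, s.y S ≤ ∑ S ∈ (A ∪ B).powerset, s.y S := by
  have h0 : ∑ S ∈ A.powerset ∩ B.powerset, s.y S = 0 := by
    refine Finset.sum_eq_zero fun S hS => ?_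
    rw [Finset.mem_inter, Finset.mem_powerset, Finset.mem_powerset] at hS
    have hSe : S = ∅ := by
      have := Finset.subset_inter hS.1 hS.2
      rwa [Finset.disjoint_iff_inter_eq_empty.mp hAB, Finset.subset_empty] at this
    by_contra hne
    exact h.sur_ne_zero S hne (by simp [hSe, sur])
  rw [← Finset.sum_union_inter, h0, add_zero]
  exact Finset.sum_le_sum_of_subset_of_nonneg (Finset.union_subset
    (Finset.powerset_mono.mpr Finset.subset_union_left)
    (Finset.powerset_mono.mpr Finset.subset_union_right)) fun S _ _ => h.y_nonneg S

theorem active_disjoint (h : Invariant k σ s) {A B : Finset (Fin m)} (hA : A ∈ s.active)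
    (hB : B ∈ s.active) (hAB : A ≠ B) : Disjoint A B :=
  Finset.disjoint_left.mpr fun v hvA hvB => hAB (h.active_unique A hA B hB v hvA hvB)

theorem dist_le_of_tightBetween (hk : 2 ≤ k) (h : Invariant k σ s) {A B : Finset (Fin m)}
    {a b : Fin m} (hT : TightBetween (dMax k) 1 σ s A B a b) {u v : Fin m} (hu : u ∈ A ∪ B)
    (hv : v ∈ A ∪ B) :
    dist (σ.pos u) (σ.pos v) + (k : ℝ) ^ 2 / 2 * (load s.y u + load s.y v)
      ≤ (k : ℝ) ^ 2 * ∑ S ∈ (A ∪ B).powerset, s.y S := by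
  obtain ⟨hA, hB, hAB, ha, hb, ht⟩ := hT
  have hk0 : (0 : ℝ) < k := by exact_mod_cast (by omega : 0 < k)
  have hsum := mul_le_mul_of_nonneg_left (h.sum_powerset_add_le (h.active_disjoint hA hB hAB))
    (sq_nonneg (k : ℝ))
  have hnn : ∀ C : Finset (Fin m), 0 ≤ (k : ℝ) ^ 2 * ∑ S ∈ C.powerset, s.y S := fun C =>
    mul_nonneg (sq_nonneg _) (Finset.sum_nonneg fun S _ => h.y_nonneg S)
  have hA0 := hnn A
  have hB0 := hnn B
  have hab : dist (σ.pos a) (σ.pos b) ≤ (k : ℝ) ^ 2 / 2 * (load s.y a + load s.y b) := by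
    have h1 := cutSum_le_load h.y_nonneg a b
    rw [ht, edgeCost_dMax hk, rate_one, one_div, inv_mul_le_iff₀ (by positivity)] at h1
    have := abs_nonneg (σ.atime a - σ.atime b)
    linarith
  have hcross : ∀ u ∈ A, ∀ v ∈ B,
      dist (σ.pos u) (σ.pos v) + (k : ℝ) ^ 2 / 2 * (load s.y u + load s.y v)
        ≤ (k : ℝ) ^ 2 * ∑ S ∈ (A ∪ B).powerset, s.y S := by
    intro u hu v hv
    have h1 := h.dist_le A hA u hu a ha
    have h2 := h.dist_le B hB b hb v hv
    have h3 := dist_triangle4 (σ.pos u) (σ.pos a) (σ.pos b) (σ.pos v)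
    linarith
  rcases Finset.mem_union.mp hu with hu | hu <;> rcases Finset.mem_union.mp hv with hv | hv
  · linarith [h.dist_le A hA u hu v hv]
  · exact hcross u hu v hv
  · rw [dist_comm, add_comm (load s.y u)]
    exact hcross v hv u hu
  · linarith [h.dist_le B hB u hu v hv]

theorem merge (hk : 2 ≤ k) (h : Invariant k σ s) {A B : Finset (Fin m)} {a b : Fin m}
    {P : Finset (Finset (Fin m))} (hT : TightBetween (dMax k) 1 σ s A B a b)
    (hP : IsPacking k (s.free (A ∪ B)) P) : Invariant k σ (s.merge A B a b P) := by
  have hdist := fun u hu v hv => h.dist_le_of_tightBetween hk hT (u := u) hu (v := v) hv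
  obtain ⟨hA, hB, hAB, ha, hb, -⟩ := hT
  obtain ⟨hPX, hPd, hPc⟩ := hP
  have hPfree : ∀ F ∈ P, ∀ v ∈ F, v ∈ A ∪ B ∧ ∀ G ∈ s.matching, v ∉ G := fun F hF v hv =>
    State.mem_free.mp ((hPX F hF).2 hv)
  have hlt : ∀ v ∈ A ∪ B, (v : ℕ) < s.arrived := fun v hv =>
    (Finset.mem_union.mp hv).elim (h.lt_arrived A hA v) (h.lt_arrived B hB v)
  have hact : ∀ C ∈ (s.merge A B a b P).active, C = A ∪ B ∨ C ∈ s.active ∧ C ≠ A ∧ C ≠ B := by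
    intro C hC
    simp only [State.merge, Finset.mem_insert, Finset.mem_erase] at hC
    tauto
  have hnot : ∀ C ∈ s.active, C ≠ A → C ≠ B → ∀ v ∈ C, v ∉ A ∪ B := by
    intro C hC hCA hCB v hv hvAB
    rcases Finset.mem_union.mp hvAB with hv' | hv'
    · exact hCA (h.active_unique C hC A hA v hv hv')
    · exact hCB (h.active_unique C hC B hB v hv hv')
  have hcov : ∀ C ∈ s.active, ∃ D ∈ (s.merge A B a b P).active, C ⊆ D := by
    intro C hC
    by_cases hCA : C = A
    · exact ⟨A ∪ B, Finset.mem_insert_self _ _, hCA ▸ Finset.subset_union_left⟩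
    by_cases hCB : C = B
    · exact ⟨A ∪ B, Finset.mem_insert_self _ _, hCB ▸ Finset.subset_union_right⟩
    exact ⟨C, Finset.mem_insert_of_mem (Finset.mem_erase.mpr ⟨hCB, Finset.mem_erase.mpr ⟨hCA, hC⟩⟩),
      Finset.Subset.rfl⟩
  have hnotP : ∀ F ∈ s.matching, F ∉ P := by
    intro F hF hFP
    obtain ⟨v, hv⟩ := Finset.card_pos.mp (((hPX F hFP).1).symm ▸ (by omega : 0 < k))
    exact (hPfree F hFP v hv).2 F hF hv
  have hcross : ∀ F ∈ s.matching, ∀ G ∈ P, Disjoint F G := fun F hF G hG =>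
    Finset.disjoint_right.mpr fun v hv => (hPfree G hG v hv).2 F hF
  constructor
  · exact h.arrived_le
  · exact h.atime_le
  · exact h.le_atime
  · intro C hC v hv
    rcases hact C hC with rfl | ⟨hC, -⟩
    · exact hlt v hv
    · exact h.lt_arrived C hC v hv
  · intro C hC D hD v hvC hvD
    rcases hact C hC with rfl | ⟨hC, hCA, hCB⟩ <;> rcases hact D hD with rfl | ⟨hD, hDA, hDB⟩
    · rfl
    · exact absurd hvC (hnot D hD hDA hDB v hvD)
    · exact absurd hvD (hnot C hC hCA hCB v hvC)
    · exact h.active_unique C hC D hD v hvC hvD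
  · intro v hv
    obtain ⟨C, hC, hvC⟩ := h.exists_active v hv
    obtain ⟨D, hD, hCD⟩ := hcov C hC
    exact ⟨D, hD, hCD hvC⟩
  · intro C hC
    rw [State.merge_free]
    rcases hact C hC with rfl | ⟨hC, hCA, hCB⟩
    · have hd := h.active_disjoint hA hB hAB
      have h1 := card_eq_uncovered_add hPX hPd
      have h2 : (s.free (A ∪ B)).card = sur k A + sur k B := by
        rw [← h.card_free A hA, ← h.card_free B hB, State.free, Finset.filter_union]
        exact Finset.card_union_of_disjoint (Finset.disjoint_filter_filter hd)
      rw [← Nat.mod_eq_of_lt hPc, ← Nat.add_mul_mod_self_right _ P.card, ← h1, h2, sur, sur, sur,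
        Finset.card_union_of_disjoint hd, ← Nat.add_mod]
    · rw [Finset.filter_eq_self.mpr, h.card_free C hC]
      exact fun v hv F hF hvF =>
        hnot C hC hCA hCB v (State.mem_free.mp hv).1 (hPfree F hF v hvF).1
  · intro F hF v hv
    rcases Finset.mem_union.mp hF with hF | hF
    · exact h.matching_lt F hF v hv
    · exact hlt v (hPfree F hF v hv).1
  · intro F hF
    exact (Finset.mem_union.mp hF).elim (h.matching_card F) fun hF => (hPX F hF).1
  · intro F hF G hG hne
    rcases Finset.mem_union.mp hF with hF | hF <;> rcases Finset.mem_union.mp hG with hG | hG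
    · exact h.matching_disjoint F hF G hG hne
    · exact hcross F hF G hG
    · exact (hcross G hG F hF).symm
    · exact hPd F hF G hG hne
  · intro F hF v hv
    simp only [State.merge]
    split_ifs with hFP
    · exact h.atime_le v (hlt v (hPfree F hFP v hv).1)
    · exact h.atime_le_mtime F ((Finset.mem_union.mp hF).resolve_right hFP) v hv
  · exact h.y_nonneg
  · intro S hS
    obtain ⟨C, hC, hSC⟩ := h.subset_active S hS
    obtain ⟨D, hD, hCD⟩ := hcov C hC
    exact ⟨D, hD, hSC.trans hCD⟩
  · exact h.sur_ne_zero
  · exact h.load_le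
  · exact h.cutSum_le
  · intro C hC u hu v hv
    rcases hact C hC with rfl | ⟨hC, -⟩
    · exact hdist u hu v hv
    · exact h.dist_le C hC u hu v hv
  · intro F hF
    rcases Finset.mem_union.mp hF with hF | hF
    · exact h.groupDist_le F hF
    · have hload : ∀ v, 0 ≤ load s.y v := fun v => Finset.sum_nonneg fun S _ => h.y_nonneg S
      refine MPMD.groupDist_le σ
        (mul_nonneg (sq_nonneg _) (Finset.sum_nonneg fun S _ => h.y_nonneg S)) fun u hu v hv => ?_
      have h1 := hdist u (hPfree F hF u hu).1 v (hPfree F hF v hv).1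
      have h2 : 0 ≤ (k : ℝ) ^ 2 / 2 * (load s.y u + load s.y v) :=
        mul_nonneg (by positivity) (add_nonneg (hload u) (hload v))
      have h3 : ∑ S ∈ (A ∪ B).powerset, s.y S ≤ ∑ S, s.y S :=
        Finset.sum_le_sum_of_subset_of_nonneg (Finset.subset_univ _) fun S _ _ => h.y_nonneg S
      have h4 := mul_le_mul_of_nonneg_left h3 (sq_nonneg (k : ℝ))
      change _ ≤ (k : ℝ) ^ 2 * ∑ S, s.y S
      linarith
  · have h1 := sum_eq_uncovered_add (X := s.waiting) (P := P)
      (fun F hF v hv => State.mem_waiting.mpr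
        ⟨hlt v (hPfree F hF v hv).1, (hPfree F hF v hv).2⟩) hPd (fun v => s.time - σ.atime v)
    have h2 : ∑ F ∈ s.matching ∪ P, ∑ v ∈ F, ((if F ∈ P then s.time else s.mtime F) - σ.atime v)
        = ∑ F ∈ s.matching, ∑ v ∈ F, (s.mtime F - σ.atime v)
          + ∑ F ∈ P, ∑ v ∈ F, (s.time - σ.atime v) := by
      rw [Finset.sum_union (Finset.disjoint_left.mpr hnotP)]
      congr 1
      · exact Finset.sum_congr rfl fun F hF => by rw [if_neg (hnotP F hF)]
      · exact Finset.sum_congr rfl fun F hF => by rw [if_pos hF]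
    have h3 := h.waiting_le
    rw [State.merge_waiting]
    change ∑ F ∈ s.matching ∪ P, ∑ v ∈ F, ((if F ∈ P then s.time else s.mtime F) - σ.atime v)
      + ∑ v ∈ s.waiting with ∀ F ∈ P, v ∉ F, (s.time - σ.atime v) ≤ _
    rw [h2]
    change _ ≤ (k : ℝ) ^ 2 * dualObjective k s.y
    linarith

theorem of_reachable (hk : 2 ≤ k) (h : Reachable (dMax k) 1 σ s) : Invariant k σ s := by
  induction h with
  | refl => exact start k σ
  | tail _ hstep ih =>
    cases hstep with
    | arrive v hv => exact ih.arrive hk hv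
    | merge A B u v P hT hP => exact ih.merge hk hT hP
    | wait δ hδ hbefore hat => exact ih.grow hk hδ hbefore

/-! ### Progress -/

theorem exists_step_of_event (hk : 2 ≤ k) (h : Event (dMax k) 1 σ s) :
    ∃ s', Step (dMax k) 1 σ s s' := by
  rcases h with ⟨v, hv⟩ | ⟨A, B, u, v, hT⟩
  · exact ⟨_, Step.arrive s v hv⟩
  · obtain ⟨P, hP⟩ := exists_isPacking (two_pos.trans_le hk) (s.free (A ∪ B))
    exact ⟨_, Step.merge s A B u v P hT hP⟩

theorem isClosed_setOf_event (k : ℕ) (σ : Inst χ m) (s : State m) :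
    IsClosed {δ : ℝ | Event (dMax k) 1 σ (s.grow (rate k 1) δ)} := by
  simp only [Event, ArrivesNow, TightBetween, State.grow_y, cutSum_add_mul, Set.ofPred_or,
    Set.ofPred_exists, Set.ofPred_and]
  refine IsClosed.union (isClosed_iUnion_of_finite fun v => ?_) (isClosed_iUnion_of_finite fun A =>
    isClosed_iUnion_of_finite fun B => isClosed_iUnion_of_finite fun u =>
      isClosed_iUnion_of_finite fun v => ?_)
  · change IsClosed ({_δ : ℝ | (v : ℕ) = s.arrived} ∩ {δ : ℝ | σ.atime v = s.time + δ})
    exact isClosed_const.inter (isClosed_eq continuous_const (by fun_prop))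
  · change IsClosed ({_δ : ℝ | A ∈ s.active} ∩ ({_δ : ℝ | B ∈ s.active} ∩ _))
    refine isClosed_const.inter (isClosed_const.inter (IsClosed.inter isClosed_const
      (IsClosed.inter isClosed_const (IsClosed.inter isClosed_const
        (isClosed_eq ?_ continuous_const)))))
    fun_prop

theorem exists_step_of_event_later (hk : 2 ≤ k) {δ : ℝ} (hδ : 0 ≤ δ)
    (h : Event (dMax k) 1 σ (s.grow (rate k 1) δ)) : ∃ s', Step (dMax k) 1 σ s s' := by
  by_cases h0 : Event (dMax k) 1 σ s
  · exact exists_step_of_event hk h0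
  set T := Set.Ici (0 : ℝ) ∩ {δ : ℝ | Event (dMax k) 1 σ (s.grow (rate k 1) δ)} with hT
  have hbdd : BddBelow T := ⟨0, fun _ hx => hx.1⟩
  have hmem : sInf T ∈ T :=
    (isClosed_Ici.inter (isClosed_setOf_event k σ s)).csInf_mem ⟨δ, hδ, h⟩ hbdd
  refine ⟨_, Step.wait s (sInf T) (lt_of_le_of_ne hmem.1 fun he => h0 ?_) (fun ε hε hlt he => ?_)
    hmem.2⟩
  · have := hmem.2
    rwa [← he, Set.mem_ofPred_eq, grow_zero] at this
  · exact absurd (csInf_le hbdd ⟨hε, he⟩) (not_le.mpr hlt)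

theorem exists_two_active (hk : 2 ≤ k) (hkm : k ∣ m) (h : Invariant k σ s) (ha : s.arrived = m)
    (hf : s.free Finset.univ ≠ ∅) : ∃ A ∈ s.active, ∃ B ∈ s.active, A ≠ B ∧
      (s.free A).Nonempty ∧ B.Nonempty := by
  obtain ⟨u, hu⟩ := Finset.nonempty_iff_ne_empty.mpr hf
  obtain ⟨A, hA, huA⟩ := h.exists_active u (u.isLt.trans_eq ha.symm)
  have hfA : (s.free A).Nonempty := ⟨u, State.mem_free.mpr ⟨huA, (State.mem_free.mp hu).2⟩⟩
  by_contra! hc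
  have hAu : s.free A = s.free Finset.univ := by
    refine Finset.filter_subset_filter _ (Finset.subset_univ A) |>.antisymm fun v hv => ?_
    obtain ⟨B, hB, hvB⟩ := h.exists_active v (v.isLt.trans_eq ha.symm)
    have hBA : A = B := by
      by_contra hne
      have := hc A hA B hB hne hfA
      simp [this] at hvB
    exact State.mem_free.mpr ⟨hBA ▸ hvB, (State.mem_free.mp hv).2⟩
  have h1 := card_eq_uncovered_add (X := Finset.univ)
    (fun F hF => ⟨h.matching_card F hF, Finset.subset_univ F⟩) h.matching_disjoint
  rw [Finset.card_univ, Fintype.card_fin] at h1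
  change m = (s.free Finset.univ).card + _ at h1
  rw [← hAu] at h1
  have h2 : k ∣ (s.free A).card := (Nat.dvd_add_left (Dvd.intro_left _ rfl)).mp (h1 ▸ hkm)
  refine hfA.card_pos.ne' (Nat.eq_zero_of_dvd_of_lt h2 ?_)
  rw [h.card_free A hA]
  exact sur_lt (by omega) A

theorem exists_event_later (hk : 2 ≤ k) (hkm : k ∣ m) (h : Invariant k σ s) (hs : ¬ s.Complete) :
    ∃ δ, 0 ≤ δ ∧ Event (dMax k) 1 σ (s.grow (rate k 1) δ) := by
  have hr : 0 < rate k 1 := by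
    have : (0 : ℝ) < k := by exact_mod_cast (by omega : 0 < k)
    rw [rate_one]; positivity
  rcases h.arrived_le.lt_or_eq with hlt | ha
  · refine ⟨σ.atime ⟨s.arrived, hlt⟩ - s.time,
      sub_nonneg.mpr (h.le_atime ⟨s.arrived, hlt⟩ le_rfl), Or.inl ⟨⟨s.arrived, hlt⟩, rfl, ?_⟩⟩
    simp [State.grow]
  obtain ⟨A, hA, B, hB, hAB, ⟨u, hu⟩, v, hvB⟩ :=
    h.exists_two_active hk hkm ha fun hf => hs ⟨ha, hf⟩
  have huA := (State.mem_free.mp hu).1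
  have hvA : v ∉ A := fun hvA => hAB (h.active_unique A hA B hB v hvA hvB)
  have hK : 0 < cutSum s.growing u v := by
    refine lt_of_lt_of_le one_pos (le_trans (le_of_eq ?_) (Finset.single_le_sum
      (fun S _ => s.growing_nonneg S) (Finset.mem_filter.mpr ⟨Finset.mem_univ A, ?_⟩)))
    · exact (if_pos ⟨hA, u, hu⟩).symm
    · tauto
  have hc := h.cutSum_le u v (u.isLt.trans_eq ha.symm) (v.isLt.trans_eq ha.symm) fun he => hvA (he ▸ huA)
  have hrK := mul_pos hr hK
  refine ⟨(rate k 1 * edgeCost (dMax k) σ u v - cutSum s.y u v) / (rate k 1 * cutSum s.growing u v),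
    div_nonneg (by linarith) hrK.le, Or.inr ⟨A, B, u, v, hA, hB, hAB, huA, hvB, ?_⟩⟩
  rw [State.grow_y, cutSum_add_mul, mul_right_comm, mul_div_cancel₀ _ hrK.ne']
  ring

theorem exists_step (hk : 2 ≤ k) (hkm : k ∣ m) (h : Invariant k σ s) (hs : ¬ s.Complete) :
    ∃ s', Step (dMax k) 1 σ s s' := by
  obtain ⟨δ, hδ, hE⟩ := h.exists_event_later hk hkm hs
  exact exists_step_of_event_later hk hδ hE

/-! ### The outcome -/

theorem isSchedule (h : Invariant k σ s) (hs : s.Complete) :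
    IsSchedule k σ s.matching s.mtime := by
  refine ⟨⟨h.matching_card, h.matching_disjoint, fun v => ?_⟩, h.atime_le_mtime⟩
  by_contra! hv
  have : v ∈ s.free Finset.univ := State.mem_free.mpr ⟨Finset.mem_univ v, hv⟩
  rw [hs.2] at this
  simp at this

theorem dualFeasible (h : Invariant k σ s) (hs : s.Complete) :
    DualFeasible (dMax k) 1 σ s.y :=
  ⟨h.y_nonneg, fun u v => h.cutSum_le u v (u.isLt.trans_eq hs.1.symm) (v.isLt.trans_eq hs.1.symm)⟩

theorem cost_le_dualObjective (hk : 2 ≤ k) (h : Invariant k σ s) (hs : s.Complete) :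
    cost (dMax k) σ s.matching s.mtime
      ≤ (4 * (m : ℝ) + (k : ℝ) ^ 2) * dualObjective k s.y := by
  have hk2 : (2 : ℝ) ≤ k := by exact_mod_cast hk
  have hfree : Finset.univ.filter (fun v : Fin m => ∀ F ∈ s.matching, v ∉ F) = ∅ := hs.2
  have hcard : s.matching.card * k = m := by
    have h1 := card_eq_uncovered_add (X := Finset.univ)
      (fun F hF => ⟨h.matching_card F hF, Finset.subset_univ F⟩) h.matching_disjoint
    rw [hfree, Finset.card_univ, Fintype.card_fin, Finset.card_empty, zero_add] at h1
    exact h1.symm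
  have hcard' : (s.matching.card : ℝ) * k = m := by exact_mod_cast hcard
  have hwaiting : s.waiting = ∅ := by
    refine Finset.subset_empty.mp (hfree ▸ fun v hv => ?_)
    exact Finset.mem_filter.mpr ⟨Finset.mem_univ v, (State.mem_waiting.mp hv).2⟩
  have hwait := h.waiting_le
  rw [hwaiting, Finset.sum_empty, add_zero] at hwait
  set Y := ∑ S, s.y S
  set D := dualObjective k s.y
  have hY : 0 ≤ Y := Finset.sum_nonneg fun S _ => h.y_nonneg S
  have hYD : ((k : ℝ) - 1) * Y ≤ D :=
    sub_one_mul_sum_le_dualObjective (by omega) h.y_nonneg h.sur_ne_zero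
  have hdist : ∑ F ∈ s.matching, groupDist (dMax k) σ F ≤ 2 * m * D := by
    calc ∑ F ∈ s.matching, groupDist (dMax k) σ F
        ≤ s.matching.card * ((k : ℝ) ^ 2 * Y) := by
          rw [← nsmul_eq_mul]
          exact Finset.sum_le_card_nsmul _ _ _ h.groupDist_le
      _ = m * (k * Y) := by rw [← hcard']; ring
      _ ≤ m * (2 * D) := by
          refine mul_le_mul_of_nonneg_left ?_ (Nat.cast_nonneg m)
          nlinarith [mul_nonneg (sub_nonneg.mpr hk2) hY]
      _ = 2 * m * D := by ring
  have hD : 0 ≤ D := le_trans (mul_nonneg (by linarith) hY) hYD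
  have hmD : 0 ≤ (m : ℝ) * D := by positivity
  rw [cost, Finset.sum_add_distrib]
  linarith

end Invariant

end MPMD

theorem theorem3 {χ : Type*} [MetricSpace χ] (k m : ℕ) (hk : 2 ≤ k) (hkm : k ∣ m)
    (σ : MPMD.Inst χ m) :
    -- the dual program has a finite optimal value, which is at most the offline optimum
    (IsLUB (MPMD.dualValues (MPMD.dMax (χ := χ) k) 1 σ) (MPMD.dualOpt (MPMD.dMax k) 1 σ) ∧
      MPMD.dualOpt (MPMD.dMax k) 1 σ ≤ MPMD.opt (MPMD.dMax k) σ) ∧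
    -- every execution stops after finitely many steps, and not before all requests are matched
    ((¬ ∃ f : ℕ → MPMD.State m, f 0 = MPMD.State.start m ∧
        ∀ n, MPMD.Step (MPMD.dMax k) 1 σ (f n) (f (n + 1))) ∧
      ∀ s, MPMD.Reachable (MPMD.dMax k) 1 σ s → ¬ s.Complete →
        ∃ s', MPMD.Step (MPMD.dMax k) 1 σ s s') ∧
    -- the outcome of every execution is a perfect matching within the claimed cost
    ∀ s, MPMD.Reachable (MPMD.dMax k) 1 σ s → s.Complete →
      MPMD.IsSchedule k σ s.matching s.mtime ∧
      MPMD.cost (MPMD.dMax k) σ s.matching s.mtime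
        ≤ (4 * (m : ℝ) + (k : ℝ) ^ 2) * MPMD.dualOpt (MPMD.dMax k) 1 σ ∧
      MPMD.cost (MPMD.dMax k) σ s.matching s.mtime
        ≤ (4 * (m : ℝ) + (k : ℝ) ^ 2) * MPMD.opt (MPMD.dMax k) σ := by
  refine ⟨⟨MPMD.isLUB_dualOpt hk hkm σ, MPMD.dualOpt_le_opt hk hkm σ⟩,
    ⟨MPMD.not_exists_infinite_execution k σ, fun s hs hc =>
      (MPMD.Invariant.of_reachable hk hs).exists_step hk hkm hc⟩, fun s hs hc => ?_⟩
  have h := MPMD.Invariant.of_reachable hk hs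
  have hcost := h.cost_le_dualObjective hk hc
  have hdual : MPMD.dualObjective k s.y ≤ MPMD.dualOpt (MPMD.dMax k) 1 σ :=
    (MPMD.isLUB_dualOpt hk hkm σ).1 ⟨s.y, h.dualFeasible hc, rfl⟩
  have hopt := MPMD.dualOpt_le_opt hk hkm σ
  refine ⟨h.isSchedule hc, hcost.trans ?_, hcost.trans ?_⟩
  · gcongr
  · gcongr
    exact hdual.trans hopt
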